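/- All rings are unital. An element $r$ of a ring is clean if $r=e+u$ with $e$ idempotent and $u$ a unit, and strongly clean if moreover $e$ and $u$ can be chosen with $eu=ue$; a ring is clean if all its elements are clean. For a commutative ring $S$ and a monic $f\in S[t]$, an SRC-factorization of $f$ in $S[t]$ is a factorization $f=f_0f_1$ with $f_0,f_1\in S[t]$ monic such that $f_0(0)$ and $f_1(1)$ are units of $S$ and the ideal $(f_0,f_1)$ equals $S[t]$. A monic polynomial $h\in R[t]$ over a commutative ring $R$ has a gSRC-factorization if there are finitely many pairwise orthogonal idempotents $e_1,\dots,e_k\in R$ with $e_1+\dots+e_k=1$ such that, for each $i$, the polynomial $e_ih$ has an SRC-factorization in $(e_iR)[t]$, where $e_iR$ is regarded as a ring with identity element $e_i$. Theorem. Let $R$ be a commutative clean ring, let $n\ge 2$, and let $h\in R[t]$ be a monic polynomial of degree $n$. Then the following are equivalent: (1) every matrix $A\in M_n(R)$ with characteristic polynomial $h$ is strongly clean (in the ring $M_n(R)$); (2) the companion matrix $C_h\in M_n(R)$ of $h$ is strongly clean (in the ring $M_n(R)$); (3) $h$ has a gSRC-factorization. -/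

import Mathlib

open Polynomial

/-- An element `a` of a (not necessarily commutative) ring is clean if it is the sum of an
idempotent and a unit. -/
def IsCleanElem {S : Type*} [Ring S] (a : S) : Prop :=
  ∃ e u : S, IsIdempotentElem e ∧ IsUnit u ∧ a = e + u

/-- An element `a` is strongly clean if it is the sum of an idempotent and a unit that commute. -/
def IsStronglyCleanElem {S : Type*} [Ring S] (a : S) : Prop :=
  ∃ e u : S, IsIdempotentElem e ∧ IsUnit u ∧ a = e + u ∧ e * u = u * e

/-- A ring is clean if each of its elements is clean. -/
def IsCleanRing (S : Type*) [Ring S] : Prop :=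
  ∀ a : S, IsCleanElem a

/-- The `n × n` companion matrix of a polynomial `h` (meant for `h` monic of degree `n`):
ones on the subdiagonal, and last column `-h₀, -h₁, …, -hₙ₋₁`. -/
def companionMat {R : Type*} [CommRing R] (n : ℕ) (h : R[X]) : Matrix (Fin n) (Fin n) R :=
  Matrix.of fun i j =>
    if (j : ℕ) + 1 = n then -h.coeff i else if (i : ℕ) = (j : ℕ) + 1 then 1 else 0

/-- `f = f₀ * f₁` is an SR-factorization (into monic factors): `f₀(0)` and `f₁(1)` are units. -/
structure IsSRFactorization {R : Type*} [CommRing R] (f f₀ f₁ : R[X]) : Prop where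
  monic_left : f₀.Monic
  monic_right : f₁.Monic
  eq_mul : f = f₀ * f₁
  isUnit_left : IsUnit (f₀.eval 0)
  isUnit_right : IsUnit (f₁.eval 1)

/-- An SRC-factorization is an SR-factorization `f = f₀ * f₁` whose factors generate the unit
ideal of `R[X]`. -/
structure IsSRCFactorization {R : Type*} [CommRing R] (f f₀ f₁ : R[X]) : Prop
    extends IsSRFactorization f f₀ f₁ where
  span_eq_top : Ideal.span {f₀, f₁} = ⊤

/-- `f` has an SRC-factorization. -/
def HasSRCFactorization {R : Type*} [CommRing R] (f : R[X]) : Prop :=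
  ∃ f₀ f₁ : R[X], IsSRCFactorization f f₀ f₁

/-- For an idempotent `e` of a commutative ring `R`, the ring homomorphism from `R` to the ring
`eR` (with identity element `e`) given by multiplication by `e`. -/
def toCorner {R : Type*} [CommRing R] {e : R} (he : IsIdempotentElem e) : R →+* he.Corner where
  toFun r := ⟨e * r * e, r, rfl⟩
  map_one' := Subtype.ext (by
    change e * 1 * e = e
    rw [mul_one, he.eq])
  map_zero' := Subtype.ext (by
    change e * 0 * e = 0
    rw [mul_zero, zero_mul])
  map_add' r s := Subtype.ext (by
    change e * (r + s) * e = e * r * e + e * s * e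
    ring)
  map_mul' r s := Subtype.ext (by
    change e * (r * s) * e = e * r * e * (e * s * e)
    linear_combination (-((e * e + e) * (r * s))) * he.eq)

/-- `h` has a gSRC-factorization: there is a (finite) complete orthogonal family of idempotents
`e₁, …, eₖ` of `R` such that, for each `i`, the polynomial `eᵢh` has an SRC-factorization in
`(eᵢR)[X]`. -/
def HasGSRCFactorization {R : Type*} [CommRing R] (h : R[X]) : Prop :=
  ∃ (k : ℕ) (e : Fin k → R) (he : CompleteOrthogonalIdempotents e),
    ∀ i : Fin k, HasSRCFactorization (h.map (toCorner (he.idem i)))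

namespace IsStronglyCleanElem

/-! For (3) ⇒ (1), split `R` into its corners, so that `χ = f₀f₁` with `a f₀ + b f₁ = 1`. By
Cayley–Hamilton `E = (a f₀)(A)` is idempotent. By `unit_identity_of_coprime`, `A - E` is a unit: it
acts as `A` where `f₀(A)` vanishes and as `A - 1` where `f₁(A)` vanishes.

For (2) ⇒ (3), write `C_h = E + U`. The coefficients of `det(XE + 1 - E)` are idempotents cutting
`R` into corners where `E` has constant rank. There the characteristic polynomials of `C_h` on the
ranges of `1 - E` and `E` are monic with product `h`, and invertibility of `U` gives the unit
conditions at `0` and `1`. They are comaximal because a common root in a residue field of `R[X]`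
would give independent eigenvectors for one eigenvalue, while eigenspaces of a companion matrix have
dimension at most one. -/

theorem map {S T : Type*} [Ring S] [Ring T] (f : S →+* T) {a : S} (ha : IsStronglyCleanElem a) :
    IsStronglyCleanElem (f a) := by
  obtain ⟨e, u, he, hu, rfl, hc⟩ := ha
  exact ⟨f e, f u, he.map f, hu.map f, map_add f e u, by rw [← map_mul, hc, map_mul]⟩

theorem pi {ι : Type*} {S : ι → Type*} [∀ i, Ring (S i)] {a : ∀ i, S i}
    (ha : ∀ i, IsStronglyCleanElem (a i)) : IsStronglyCleanElem a := by
  choose e u he hu ha hc using ha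
  exact ⟨e, u, funext he, Pi.isUnit_iff.2 hu, funext ha, funext hc⟩

end IsStronglyCleanElem

/-! ### From factorizations to strong cleanness -/

section SRCToClean

/-- Since `a f₀` is `0` mod `f₀` and `1` mod `f₁`, `x - a f₀` reduces to `x` and `x - 1`, with
inverses `-g₀d₀` and `-g₁d₁`. The second factor glues these as in the Chinese remainder theorem. -/
theorem unit_identity_of_coprime {P : Type*} [CommRing P] {x f₀ f₁ a b c₀ c₁ d₀ d₁ g₀ g₁ : P}
    (hab : a * f₀ + b * f₁ = 1) (h₀ : f₀ = c₀ + x * g₀) (h₁ : f₁ = c₁ + (x - 1) * g₁)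
    (hd₀ : c₀ * d₀ = 1) (hd₁ : c₁ * d₁ = 1) :
    (x - a * f₀) * (-(a * f₀) * g₁ * d₁ - (1 - a * f₀) * g₀ * d₀) =
      1 + f₀ * f₁ * (a * b * (g₀ * d₀ - g₁ * d₁) - a * d₁ - b * d₀) := by
  have hx₀ : x * g₀ * d₀ = f₀ * d₀ - 1 := by linear_combination (-d₀) * h₀ - hd₀
  have hx₁ : (x - 1) * g₁ * d₁ = f₁ * d₁ - 1 := by linear_combination (-d₁) * h₁ - hd₁
  have hb : 1 - a * f₀ = b * f₁ := by linear_combination -hab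
  have e₁ : (x - a * f₀) * (a * f₀) = (x - 1) * (a * f₀) + (a * f₀) * (b * f₁) := by
    rw [← hb]; ring
  have e₂ : (x - a * f₀) * (1 - a * f₀) = x * (1 - a * f₀) - (a * f₀) * (b * f₁) := by
    rw [← hb]; ring
  calc _ = -((x - a * f₀) * (a * f₀)) * (g₁ * d₁) - ((x - a * f₀) * (1 - a * f₀)) * (g₀ * d₀) := by
        ring
    _ = _ := by
        rw [e₁, e₂, hb]
        linear_combination (-(a * f₀)) * hx₁ - (b * f₁) * hx₀ + hab

/-- A matrix whose characteristic polynomial has an SRC-factorization is strongly clean. -/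
theorem HasSRCFactorization.isStronglyCleanElem {S : Type*} [CommRing S] {n : Type*} [Fintype n]
    [DecidableEq n] {A : Matrix n n S} (hA : HasSRCFactorization A.charpoly) :
    IsStronglyCleanElem A := by
  obtain ⟨f₀, f₁, h⟩ := hA
  obtain ⟨a, b, hab⟩ := Ideal.mem_span_pair.1
    (h.span_eq_top ▸ Submodule.mem_top : (1 : S[X]) ∈ Ideal.span {f₀, f₁})
  obtain ⟨d₀, hd₀⟩ := h.isUnit_left.exists_right_inv
  obtain ⟨d₁, hd₁⟩ := h.isUnit_right.exists_right_inv
  obtain ⟨g₀, hg₀⟩ := X_sub_C_dvd_sub_C_eval (a := (0 : S)) (p := f₀)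
  obtain ⟨g₁, hg₁⟩ := X_sub_C_dvd_sub_C_eval (a := (1 : S)) (p := f₁)
  have hχ : aeval A (f₀ * f₁) = 0 := by rw [← h.eq_mul, Matrix.aeval_self_charpoly]
  have key := unit_identity_of_coprime (x := (X : S[X])) (c₀ := C (f₀.eval 0))
    (c₁ := C (f₁.eval 1)) (d₀ := C d₀) (d₁ := C d₁) (g₀ := g₀) (g₁ := g₁) hab
    (by rw [C_0, sub_zero] at hg₀; linear_combination hg₀)
    (by rw [C_1] at hg₁; linear_combination hg₁)
    (by rw [← C_mul, hd₀, C_1]) (by rw [← C_mul, hd₁, C_1])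
  set V : S[X] := -(a * f₀) * g₁ * C d₁ - (1 - a * f₀) * g₀ * C d₀ with hV
  have hidem : (a * f₀) * (a * f₀) = a * f₀ - f₀ * f₁ * (a * b) := by
    linear_combination (a * f₀) * hab
  have hUV : aeval A (X - a * f₀) * aeval A V = 1 := by
    rw [← map_mul, key, map_add, map_one, map_mul, hχ, zero_mul, add_zero]
  refine ⟨aeval A (a * f₀), aeval A (X - a * f₀), ?_, ?_, ?_, ?_⟩
  · rw [IsIdempotentElem, ← map_mul, hidem, map_sub, map_mul _ (f₀ * f₁), hχ, zero_mul, sub_zero]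
  · exact .of_mul_eq_one _ hUV
  · rw [← map_add, add_sub_cancel, aeval_X]
  · rw [← map_mul, mul_comm, map_mul]

theorem HasGSRCFactorization.isStronglyCleanElem {R : Type*} [CommRing R] {n : Type*} [Fintype n]
    [DecidableEq n] {A : Matrix n n R} (hA : HasGSRCFactorization A.charpoly) :
    IsStronglyCleanElem A := by
  obtain ⟨k, e, he, H⟩ := hA
  let φ : Matrix n n R ≃+* Π i, Matrix n n (he.idem i).Corner :=
    he.ringEquivOfComm.mapMatrix.trans Matrix.piRingEquiv
  have hφ : IsStronglyCleanElem (φ A) := by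
    refine .pi fun i ↦ ?_
    have hi : φ A i = A.map (toCorner (he.idem i)) := rfl
    rw [hi]
    refine HasSRCFactorization.isStronglyCleanElem ?_
    rw [Matrix.charpoly_map]
    exact H i
  simpa using hφ.map (φ.symm : _ →+* Matrix n n R)

end SRCToClean

/-! ### Companion matrices and their eigenvectors -/

section Companion

theorem companionMat_map {R S : Type*} [CommRing R] [CommRing S] (f : R →+* S) (n : ℕ) (h : R[X]) :
    (companionMat n h).map f = companionMat n (h.map f) := by
  ext i j
  simp [companionMat, apply_ite f]

/-- The non-last columns of the companion matrix shift the standard basis. -/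
theorem companionMat_mulVec_single {R : Type*} [CommRing R] {n : ℕ} (h : R[X]) {i : ℕ}
    (hi : i + 1 < n) :
    (companionMat n h).mulVec (Pi.single ⟨i, by omega⟩ 1) = Pi.single ⟨i + 1, hi⟩ 1 := by
  ext k
  have : i + 1 ≠ n := hi.ne
  simp [companionMat, Pi.single_apply, this, Fin.ext_iff]

theorem companionMat_pow_mulVec {R : Type*} [CommRing R] {n : ℕ} (h : R[X]) (i : ℕ) (hi : i < n) :
    ((companionMat n h) ^ i).mulVec (Pi.single ⟨0, by omega⟩ 1) = Pi.single ⟨i, hi⟩ 1 := by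
  induction i with
  | zero => rw [pow_zero, Matrix.one_mulVec]
  | succ i ih =>
    rw [pow_succ', ← Matrix.mulVec_mulVec, ih (by omega), companionMat_mulVec_single h hi]

theorem aeval_companionMat_mulVec {R : Type*} [CommRing R] {n : ℕ} (hn : 0 < n) (h q : R[X])
    (hq : q.natDegree < n) (k : Fin n) :
    (aeval (companionMat n h) q).mulVec (Pi.single ⟨0, hn⟩ 1) k = q.coeff k := by
  rw [aeval_eq_sum_range' hq, Matrix.sum_mulVec,
    Finset.sum_apply, Finset.sum_eq_single (k : ℕ)]
  · rw [Matrix.smul_mulVec, companionMat_pow_mulVec h _ k.2]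
    simp
  · intro i hi hik
    rw [Matrix.smul_mulVec, companionMat_pow_mulVec h _ (Finset.mem_range.1 hi)]
    simp [Fin.ext_iff, Ne.symm hik]
  · intro hk
    exact absurd (Finset.mem_range.2 k.2) hk

theorem companionMat_pow_mulVec_self {R : Type*} [CommRing R] {n : ℕ} (hn : 0 < n) (h : R[X])
    (k : Fin n) :
    ((companionMat n h) ^ n).mulVec (Pi.single ⟨0, hn⟩ 1) k = -h.coeff k := by
  obtain ⟨m, rfl⟩ : ∃ m, n = m + 1 := ⟨n - 1, by omega⟩
  rw [pow_succ', ← Matrix.mulVec_mulVec, companionMat_pow_mulVec h m (by omega)]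
  simp [companionMat]

/-- As `Cⁱe₀ = eᵢ` for `i < n`, Cayley–Hamilton applied to `e₀` reads off the coefficients of `χ -
Xⁿ`. -/
theorem companionMat_charpoly {R : Type*} [CommRing R] {n : ℕ} (hn : 0 < n) {h : R[X]}
    (hm : h.Monic) (hd : h.natDegree = n) : (companionMat n h).charpoly = h := by
  cases subsingleton_or_nontrivial R
  · exact Subsingleton.elim _ _
  set χ := (companionMat n h).charpoly with hχ
  have hχm : χ.Monic := Matrix.charpoly_monic _
  have hχd : χ.natDegree = n := by rw [hχ, Matrix.charpoly_natDegree_eq_dim, Fintype.card_fin]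
  have hq : (χ - X ^ n).natDegree < n := by
    rcases eq_or_ne (χ - X ^ n) 0 with h₀ | h₀
    · rw [h₀, natDegree_zero]
      exact hn
    · rw [natDegree_lt_iff_degree_lt h₀]
      have := degree_sub_lt_left (p := χ) (q := X ^ n) (by
        rw [degree_X_pow, degree_eq_natDegree hχm.ne_zero, hχd]) hχm.ne_zero
        (by rw [hχm.leadingCoeff, (monic_X_pow n).leadingCoeff])
      rwa [degree_eq_natDegree hχm.ne_zero, hχd] at this
  have hlow : ∀ k < n, χ.coeff k = h.coeff k := by
    intro k hk
    have h₁ := aeval_companionMat_mulVec hn h _ hq ⟨k, hk⟩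
    rw [map_sub, map_pow, aeval_X, Matrix.aeval_self_charpoly, zero_sub, Matrix.neg_mulVec,
      Pi.neg_apply, companionMat_pow_mulVec_self hn h ⟨k, hk⟩, neg_neg] at h₁
    simpa [coeff_X_pow, hk.ne] using h₁.symm
  ext k
  rcases lt_trichotomy k n with hk | rfl | hk
  · exact hlow k hk
  · have h₁ := hχm.coeff_natDegree
    have h₂ := hm.coeff_natDegree
    rw [hχd] at h₁
    rw [hd] at h₂
    rw [h₁, h₂]
  · rw [coeff_eq_zero_of_natDegree_lt (hχd ▸ hk), coeff_eq_zero_of_natDegree_lt (hd ▸ hk)]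

/-- An eigenvector of a companion matrix is determined by its last coordinate. -/
theorem companionMat_eigenvector_eq_zero {R : Type*} [CommRing R] {n : ℕ} (h : R[X]) {τ : R}
    {v : Fin n → R} (hv : (companionMat n h).mulVec v = τ • v)
    (hlast : ∀ j : Fin n, (j : ℕ) + 1 = n → v j = 0) : v = 0 := by
  -- Upward induction from the last coordinate: once that is zero, row `j + 1` reads `v j = τ * v (j
  -- + 1)`.
  have step : ∀ k : ℕ, ∀ j : Fin n, (j : ℕ) + 1 + k = n → v j = 0 := by
    intro k
    induction k with
    | zero => exact hlast
    | succ k ih =>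
      intro j hj
      have hj' : (j : ℕ) + 1 < n := by omega
      have h₁ := congrFun hv ⟨j + 1, hj'⟩
      rw [Pi.smul_apply, ih ⟨j + 1, hj'⟩ (by simp only; omega), smul_zero, Matrix.mulVec, dotProduct,
        Finset.sum_eq_single j] at h₁
      · simpa [companionMat, hj'.ne] using h₁
      · intro i _ hij
        by_cases hi : (i : ℕ) + 1 = n
        · rw [hlast i hi, mul_zero]
        · have : (j : ℕ) ≠ i := fun e ↦ hij (Fin.ext e.symm)
          simp [companionMat, hi, this]
      · simp
  ext j
  exact step (n - (j + 1)) j (by omega)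

/-- Eigenspaces of a companion matrix over a domain have rank at most one. -/
theorem companionMat_eigenvectors_dependent {K : Type*} [CommRing K] [IsDomain K] {n : ℕ}
    (h : K[X]) {τ : K} {v w : Fin n → K} (hv : (companionMat n h).mulVec v = τ • v)
    (hw : (companionMat n h).mulVec w = τ • w) {E : Matrix (Fin n) (Fin n) K}
    (hEv : E.mulVec v = 0) (hEw : E.mulVec w = w) : v = 0 ∨ w = 0 := by
  by_contra! hne
  refine hne.1 (companionMat_eigenvector_eq_zero h hv fun j hj ↦ ?_)
  have hz : v j • w - w j • v = 0 := by
    refine companionMat_eigenvector_eq_zero h (τ := τ) ?_ fun i hi ↦ ?_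
    · rw [Matrix.mulVec_sub, Matrix.mulVec_smul, Matrix.mulVec_smul, hv, hw, smul_sub,
        smul_comm τ, smul_comm τ]
    · obtain rfl : i = j := Fin.ext (by omega)
      simp [mul_comm]
  have h₁ := congrArg E.mulVec hz
  rw [Matrix.mulVec_sub, Matrix.mulVec_smul, Matrix.mulVec_smul, hEv, hEw, smul_zero, sub_zero,
    Matrix.mulVec_zero, smul_eq_zero] at h₁
  exact h₁.resolve_right hne.2

end Companion

/-! ### Rank idempotents of an idempotent matrix -/

section RankPolynomial

open Matrix

variable {n : Type*} [Fintype n] [DecidableEq n]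

/-- For an idempotent matrix `E`, the coefficient of `X ^ r` in `det (X E + (1 - E))` is the
idempotent that cuts out the locus where `E` has rank `r`. -/
noncomputable def rankPoly {R : Type*} [CommRing R] (E : Matrix n n R) : R[X] :=
  det ((X : R[X]) • E.map C + (1 - E).map C)

theorem map_rankPoly {R A : Type*} [CommRing R] [CommRing A] (E : Matrix n n R) (f : R[X] →+* A) :
    f (rankPoly E) =
      det (f X • (f.comp C).mapMatrix E + (1 - (f.comp C).mapMatrix E)) := by
  rw [rankPoly, RingHom.map_det]
  congr 1
  ext i j
  simp [Matrix.one_apply, apply_ite]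
  exact mul_comm _ _

theorem rankPoly_map {R S : Type*} [CommRing R] [CommRing S] (E : Matrix n n R) (f : R →+* S) :
    rankPoly (E.map f) = (rankPoly E).map f := by
  rw [← coe_mapRingHom, map_rankPoly, rankPoly]
  congr 1
  ext i j
  simp [Matrix.one_apply, apply_ite]

theorem smul_idempotent_mul {T M : Type*} [CommRing T] [Ring M] [Algebra T M] {E : M}
    (hE : IsIdempotentElem E) (x y : T) :
    (x • E + (1 - E)) * (y • E + (1 - E)) = (x * y) • E + (1 - E) := by
  rw [add_mul, mul_add, mul_add, hE.one_sub.eq]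
  simp [hE.eq, mul_sub, sub_mul, smul_smul, mul_comm x y]

theorem map_rankPoly_mul {R A : Type*} [CommRing R] [CommRing A] {E : Matrix n n R}
    (hE : IsIdempotentElem E) (f g k : R[X] →+* A) (hg : g.comp C = f.comp C)
    (hk : k.comp C = f.comp C) (hX : k X = f X * g X) :
    k (rankPoly E) = f (rankPoly E) * g (rankPoly E) := by
  rw [map_rankPoly, map_rankPoly, map_rankPoly, hg, hk, hX, ← det_mul,
    smul_idempotent_mul (hE.map (f.comp C).mapMatrix)]

theorem rankPoly_coeff_mul_coeff {R : Type*} [CommRing R] {E : Matrix n n R}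
    (hE : IsIdempotentElem E) (i j : ℕ) :
    (rankPoly E).coeff i * (rankPoly E).coeff j = if i = j then (rankPoly E).coeff i else 0 := by
  -- With two independent variables this is `p(XY) = p(X)p(Y)`; comparing coefficients gives
  -- orthogonality.
  have h := map_rankPoly_mul hE (C : R[X] →+* R[X][X]) (mapRingHom (C : R →+* R[X]))
    (eval₂RingHom ((C : R[X] →+* R[X][X]).comp C) (C X * X)) (by ext; simp) (by ext; simp)
    (by simp)
  have h₁ := congrArg (fun p : R[X][X] ↦ (p.coeff j).coeff i) h
  have h₂ : eval₂RingHom ((C : R[X] →+* R[X][X]).comp C) (C X * X) (rankPoly E) =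
      (rankPoly E).sum fun k a ↦ C (C a * X ^ k) * X ^ k := by
    rw [coe_eval₂RingHom, eval₂_eq_sum]
    simp only [mul_pow, RingHom.comp_apply, C_mul, C_pow, mul_assoc]
  rw [h₂] at h₁
  simp only [coe_mapRingHom, coeff_C_mul, coeff_map, coeff_mul_C, Polynomial.sum_def,
    finsetSum_coeff, coeff_X_pow, mul_ite, mul_one, mul_zero] at h₁
  rw [← h₁, Finset.sum_eq_single j]
  · rw [if_pos rfl, coeff_C_mul, coeff_X_pow]
    split_ifs with hij <;> simp [hij]
  · intro b _ hb
    rw [if_neg (Ne.symm hb), coeff_zero]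
  · intro hj
    simp [notMem_support_iff.1 hj]

theorem rankPoly_completeOrthogonalIdempotents {R : Type*} [CommRing R] {E : Matrix n n R}
    (hE : IsIdempotentElem E) :
    CompleteOrthogonalIdempotents
      fun i : Fin (Fintype.card n + 1) ↦ (rankPoly E).coeff (i : ℕ) := by
  refine ⟨OrthogonalIdempotents.iff_mul_eq.2 fun i j ↦ ?_, ?_⟩
  · simp [rankPoly_coeff_mul_coeff hE, Fin.ext_iff]
  · rw [Fin.sum_univ_eq_sum_range (fun i ↦ (rankPoly E).coeff i)]
    have h₁ : evalRingHom (1 : R) (rankPoly E) = 1 := by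
      rw [map_rankPoly]; simp
    have hdeg : (rankPoly E).natDegree < Fintype.card n + 1 :=
      Nat.lt_succ_of_le (natDegree_det_X_add_C_le _ _)
    rw [coe_evalRingHom, eval_eq_sum_range' hdeg] at h₁
    simpa using h₁

/-- On the corner of its `r`-th rank idempotent, `E` has rank polynomial `X ^ r`. -/
theorem rankPoly_map_toCorner {R : Type*} [CommRing R] {E : Matrix n n R}
    (hE : IsIdempotentElem E) (r : ℕ) (hr : IsIdempotentElem ((rankPoly E).coeff r)) :
    rankPoly (E.map (toCorner hr)) = X ^ r := by
  rw [rankPoly_map]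
  ext j
  rw [coeff_map, coeff_X_pow]
  refine Subtype.ext ?_
  change (rankPoly E).coeff r * (rankPoly E).coeff j * (rankPoly E).coeff r = _
  rw [rankPoly_coeff_mul_coeff hE]
  by_cases h : j = r
  · subst h
    simp only [if_true, hr.eq]
    rfl
  · simp only [if_neg h, if_neg (Ne.symm h), zero_mul]
    rfl

end RankPolynomial

/-! ### Characteristic polynomials on Peirce components -/

section PartCharpoly

open Matrix

variable {n : Type*} [Fintype n] [DecidableEq n]

/-- The characteristic polynomial of the restriction of `A` to the range of a commuting
idempotent `E`. -/
noncomputable def partCharpoly {R : Type*} [CommRing R] (A E : Matrix n n R) : R[X] :=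
  det (charmatrix A * C.mapMatrix E + (1 - C.mapMatrix E))

theorem map_partCharpoly {R K : Type*} [CommRing R] [CommRing K] (A E : Matrix n n R)
    (f : R[X] →+* K) :
    f (partCharpoly A E) =
      det ((scalar n (f X) - (f.comp C).mapMatrix A) * (f.comp C).mapMatrix E +
        (1 - (f.comp C).mapMatrix E)) := by
  have h₁ : f.mapMatrix (charmatrix A) = scalar n (f X) - (f.comp C).mapMatrix A := by
    ext i j
    by_cases h : i = j <;> simp [charmatrix, h]
  have h₂ : f.mapMatrix (C.mapMatrix E) = (f.comp C).mapMatrix E := rfl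
  rw [partCharpoly, RingHom.map_det, map_add, map_mul, map_sub, map_one, h₁, h₂]

theorem commute_charmatrix {R : Type*} [CommRing R] {A E : Matrix n n R} (h : Commute A E) :
    Commute (charmatrix A) (C.mapMatrix E) := by
  rw [charmatrix]
  exact (scalar_commute _ (fun _ ↦ Commute.all _ _) _).sub_left (h.map C.mapMatrix)

theorem peirce_mul {M : Type*} [Ring M] {D E : M} (hE : IsIdempotentElem E) (h : Commute D E) :
    (D * (1 - E) + (1 - (1 - E))) * (D * E + (1 - E)) = D := by
  have h₁ : (1 - E) * D = D * (1 - E) := by rw [sub_mul, mul_sub, h.eq, one_mul, mul_one]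
  have h₂ : (1 - E) * E = 0 := hE.one_sub_mul_self
  have h₃ : E * (1 - E) = 0 := hE.mul_one_sub_self
  calc _ = D * ((1 - E) * D) * E + D * ((1 - E) * (1 - E)) + E * D * E + E * (1 - E) := by
        noncomm_ring
    _ = D := by
      rw [h₁, hE.one_sub.eq, h₃, mul_assoc D (D * (1 - E)), mul_assoc D (1 - E), h₂, ← h.eq,
        mul_assoc D E E, hE.eq]
      noncomm_ring

theorem partCharpoly_mul {R : Type*} [CommRing R] {A E : Matrix n n R} (hE : IsIdempotentElem E)
    (h : Commute A E) : partCharpoly A (1 - E) * partCharpoly A E = A.charpoly := by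
  rw [partCharpoly, partCharpoly, ← det_mul, map_sub, map_one,
    peirce_mul (hE.map C.mapMatrix) (commute_charmatrix h), charpoly]

theorem smul_peirce {T M : Type*} [CommRing T] [Ring M] [Algebra T M] {A E : M}
    (hE : IsIdempotentElem E) (h : Commute A E) (x : T) :
    (x • E + (1 - E)) * (x • 1 - A * E) = x • ((x • 1 - A) * E + (1 - E)) := by
  have h₁ : E * (A * E) = A * E := by rw [← mul_assoc, ← h.eq, mul_assoc, hE.eq]
  simp only [add_mul, mul_sub, sub_mul, smul_mul_assoc, mul_smul_comm, one_mul, mul_one, h₁,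
    smul_add, smul_sub]
  abel

/-- Constant rank makes `Xⁿ * partCharpoly A E` equal to the monic `Xʳ * charpoly (A * E)`, and `Xⁿ`
cancels. -/
theorem partCharpoly_monic {R : Type*} [CommRing R] {A E : Matrix n n R}
    (hE : IsIdempotentElem E) (h : Commute A E) {r : ℕ} (hr : rankPoly E = X ^ r) :
    (partCharpoly A E).Monic := by
  have hs : ∀ B : Matrix n n R, charmatrix B = (X : R[X]) • 1 - C.mapMatrix B := fun B ↦ by
    rw [charmatrix, smul_one_eq_diagonal, scalar_apply]
  have hp : rankPoly E = det ((X : R[X]) • C.mapMatrix E + (1 - C.mapMatrix E)) := by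
    simpa using map_rankPoly E (RingHom.id R[X])
  have key : X ^ Fintype.card n * partCharpoly A E = X ^ r * (A * E).charpoly := by
    rw [← hr, hp, partCharpoly, charpoly, ← det_mul, hs, hs, map_mul,
      smul_peirce (hE.map C.mapMatrix) (h.map C.mapMatrix), det_smul]
  refine (monic_X_pow (Fintype.card n)).of_mul_monic_left ?_
  rw [key]
  exact (monic_X_pow r).mul (charpoly_monic _)

theorem isUnit_peirce {M : Type*} [Ring M] {U E : M} (hE : IsIdempotentElem E) (hU : IsUnit U)
    (h : Commute U E) : IsUnit (-U * E + (1 - E)) := by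
  obtain ⟨u, rfl⟩ := hU
  have aux : ∀ {V W : M}, Commute W E → V * W = 1 → (-V * E + (1 - E)) * (-W * E + (1 - E)) = 1 := by
    intro V W hW hVW
    have h₁ : E * W * E = W * E := by rw [← hW.eq, mul_assoc, hE.eq]
    have h₂ : (1 - E) * W * E = 0 := by rw [sub_mul, sub_mul, h₁, one_mul, sub_self]
    calc _ = V * (E * W * E) - V * (E * (1 - E)) - (1 - E) * W * E + (1 - E) * (1 - E) := by
          noncomm_ring
      _ = 1 := by
        rw [h₁, h₂, hE.mul_one_sub_self, hE.one_sub.eq, ← mul_assoc, hVW]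
        noncomm_ring
  exact ⟨⟨_, -↑u⁻¹ * E + (1 - E), aux h.units_inv_left u.mul_inv, aux h u.inv_mul⟩, rfl⟩

/-- The two parts of a companion matrix with respect to a commuting idempotent have comaximal
characteristic polynomials. -/
theorem span_partCharpoly_companionMat {R : Type*} [CommRing R] {m : ℕ} {h : R[X]}
    {E : Matrix (Fin m) (Fin m) R} (hE : IsIdempotentElem E) (hc : Commute (companionMat m h) E) :
    Ideal.span {partCharpoly (companionMat m h) (1 - E), partCharpoly (companionMat m h) E} =
      ⊤ := by
  by_contra hne
  obtain ⟨I, hI, hle⟩ := Ideal.exists_le_maximal _ hne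
  let φ := Ideal.Quotient.mk I
  set ψ := φ.comp C with hψ
  have hker : ∀ F : Matrix (Fin m) (Fin m) R, IsIdempotentElem F →
      Commute (companionMat m h) F → partCharpoly (companionMat m h) F ∈ I →
      ∃ v ≠ 0, (ψ.mapMatrix F).mulVec v = v ∧
        (companionMat m (h.map ψ)).mulVec v = φ X • v := by
    intro F hF hcF hmem
    have h₀ := map_partCharpoly (companionMat m h) F φ
    rw [Ideal.Quotient.eq_zero_iff_mem.2 hmem, eq_comm, ← exists_mulVec_eq_zero_iff] at h₀
    obtain ⟨v, hv, h₁⟩ := h₀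
    have hA : ψ.mapMatrix (companionMat m h) = companionMat m (h.map ψ) := companionMat_map ψ m h
    have hF' := hF.map ψ.mapMatrix
    have hcF' := hcF.map ψ.mapMatrix
    rw [← hψ] at h₁
    rw [hA] at hcF' h₁
    set B := companionMat m (h.map ψ)
    set G := ψ.mapMatrix F
    have hD : Commute (scalar (Fin m) (φ X) - B) G :=
      (scalar_commute _ (fun _ ↦ Commute.all _ _) _).sub_left hcF'
    set D := scalar (Fin m) (φ X) - B with hDdef
    -- Applying `1 - G` kills the `D * G` term, so the kernel vector lies in the range of `G`.
    have h₂ : (1 - G).mulVec v = 0 := by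
      have := congrArg (1 - G).mulVec h₁
      rwa [mulVec_mulVec, mulVec_zero, mul_add, hD.eq, ← mul_assoc, hF'.one_sub_mul_self, zero_mul,
        zero_add, hF'.one_sub.eq] at this
    have h₃ : G.mulVec v = v := by
      rw [sub_mulVec, one_mulVec, sub_eq_zero] at h₂
      exact h₂.symm
    rw [add_mulVec, h₂, add_zero, ← mulVec_mulVec, h₃, hDdef, sub_mulVec, sub_eq_zero] at h₁
    refine ⟨v, hv, h₃, h₁.symm.trans ?_⟩
    rw [scalar_apply, ← smul_one_eq_diagonal, smul_mulVec, one_mulVec]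
  have hc' : Commute (companionMat m h) (1 - E) := (Commute.one_right _).sub_right hc
  obtain ⟨v, hv, hEv, hAv⟩ := hker (1 - E) hE.one_sub hc' (hle (Ideal.subset_span (by simp)))
  obtain ⟨w, hw, hEw, hAw⟩ := hker E hE hc (hle (Ideal.subset_span (by simp)))
  have hEv' : (ψ.mapMatrix E).mulVec v = 0 := by
    rw [map_sub, map_one, sub_mulVec, one_mulVec, sub_eq_self] at hEv
    exact hEv
  exact (companionMat_eigenvectors_dependent _ hAv hAw hEv' hEw).elim hv hw

/-- If the companion matrix of `h` is the sum of a unit and a commuting idempotent of constant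
rank, then `h` has an SRC-factorization. -/
theorem HasSRCFactorization.of_companionMat {R : Type*} [CommRing R] {m : ℕ}
    {h : R[X]} (hmon : h.Monic) (hdeg : (companionMat m h).charpoly = h)
    {E U : Matrix (Fin m) (Fin m) R} (hE : IsIdempotentElem E) (hU : IsUnit U)
    (hsum : companionMat m h = E + U) (hc : Commute E U) {r : ℕ} (hr : rankPoly E = X ^ r) :
    HasSRCFactorization h := by
  have hcA : Commute (companionMat m h) E := by
    rw [hsum]; exact (Commute.refl E).add_left hc.symm
  have hmul := (partCharpoly_mul hE hcA).trans hdeg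
  have hmonic₁ := partCharpoly_monic hE hcA hr
  have hev : ∀ (F : Matrix (Fin m) (Fin m) R) (x : R),
      (partCharpoly (companionMat m h) F).eval x =
        det ((scalar (Fin m) x - companionMat m h) * F + (1 - F)) := by
    intro F x
    have h₁ := map_partCharpoly (companionMat m h) F (evalRingHom x)
    have h₂ : (evalRingHom x).comp C = RingHom.id R := by ext; simp
    have h₃ : (RingHom.id R).mapMatrix = RingHom.id (Matrix (Fin m) (Fin m) R) := by ext; simp
    rw [h₂, h₃] at h₁
    simpa using h₁
  refine ⟨partCharpoly (companionMat m h) (1 - E), partCharpoly (companionMat m h) E,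
    ⟨hmonic₁.of_mul_monic_right (hmul.symm ▸ hmon), hmonic₁, hmul.symm, ?_, ?_⟩,
    span_partCharpoly_companionMat hE hcA⟩
  · rw [hev, ← isUnit_iff_isUnit_det, map_zero, hsum]
    have h₁ := isUnit_peirce hE.one_sub hU ((Commute.one_right _).sub_right hc.symm)
    convert h₁ using 2
    rw [zero_sub, neg_mul, neg_mul, add_mul, hE.mul_one_sub_self, zero_add]
  · rw [hev, ← isUnit_iff_isUnit_det, map_one, hsum]
    convert isUnit_peirce hE hU hc.symm using 2
    rw [sub_mul, add_mul, hE.eq, one_mul, neg_mul]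
    abel

end PartCharpoly

/-! ### Assembling the equivalence -/

theorem HasGSRCFactorization.of_isStronglyCleanElem {R : Type*} [CommRing R] {n : ℕ} (hn : 0 < n)
    {h : R[X]} (hmonic : h.Monic) (hdeg : h.natDegree = n)
    (hC : IsStronglyCleanElem (companionMat n h)) : HasGSRCFactorization h := by
  obtain ⟨E, U, hE, hU, hsum, hc⟩ := hC
  refine ⟨Fintype.card (Fin n) + 1, _, rankPoly_completeOrthogonalIdempotents hE, fun i ↦ ?_⟩
  set f := toCorner ((rankPoly_completeOrthogonalIdempotents hE).idem i) with hf
  have hmap : (companionMat n h).map f = companionMat n (h.map f) := companionMat_map f n h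
  refine .of_companionMat (hmonic.map f) ?_ (hE.map f.mapMatrix) (hU.map f.mapMatrix) ?_
    ?_ (rankPoly_map_toCorner hE i _)
  · rw [← hmap, Matrix.charpoly_map, companionMat_charpoly hn hmonic hdeg]
  · rw [← hmap, ← map_add, ← hsum]; rfl
  · exact (show Commute E U from hc).map f.mapMatrix

theorem mainTheorem1 {R : Type*} [CommRing R] (hR : IsCleanRing R) (n : ℕ) (hn : 2 ≤ n)
    (h : R[X]) (hmonic : h.Monic) (hdeg : h.natDegree = n) :
    List.TFAE [
      ∀ A : Matrix (Fin n) (Fin n) R, A.charpoly = h → IsStronglyCleanElem A,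
      IsStronglyCleanElem (companionMat n h),
      HasGSRCFactorization h] := by
  have hn₀ : 0 < n := by omega
  tfae_have 1 → 2 := fun H ↦ H _ (companionMat_charpoly hn₀ hmonic hdeg)
  tfae_have 2 → 3 := HasGSRCFactorization.of_isStronglyCleanElem hn₀ hmonic hdeg
  tfae_have 3 → 1 := fun H A hA ↦ HasGSRCFactorization.isStronglyCleanElem (hA.symm ▸ H)
  tfae_finish
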